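/- **Setting.** Fix a finite set $T$ of terminals (parts of speech). A grammar $G$ over a set $V$ of nonterminals (with a start symbol $S\notin V$) consists of a finite set $\mathrm{core}(G)$ of core rules $X\to YZ$ or $S\to X$ ($X,Y,Z\in V$) and a finite set $\mathrm{pos}(G)$ of POS assignment rules $X\to x$ ($X\in V$, $x\in T$); $L(G)$ is its language, and $G'\subseteq G$ means inclusion of both rule sets. A parse tree is *basic* if the sequence of nonterminals on every root-to-leaf path is a concatenation of two sequences without repetitions (at most one recursion along a path), and $B_G$ is the finite set of strings that have a basic parse tree in $G$. For a finite set $D$ of strings let $ES(D|G)_i$ and $GS(G)_i$ be the numbers of strings of length $i$ in $D\cap B_G$ and in $B_G$, and let $$f(D|G)=\frac{\sum_i ES(D|G)_i}{\sum_i GS(G)_i},$$ which is defined if $B_G\neq\emptyset$. **Class.** For $m,k\in\mathbb N$, $G\in\mathcal C_{m,k}$ if there are grammars $G_1,\dots,G_n=G$ ($n\ge 1$) over $V$ with $|\mathrm{core}(G_1)|\le m$ and, for $1\le i<n$, $G_i\subsetneq G_{i+1}$, $L(G_i)\subsetneq L(G_{i+1})$ and $|\mathrm{core}(G_{i+1})|-|\mathrm{core}(G_i)|\le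 k$. Such a sequence is a *non-increasing optimal path* for $D$ if every $f(D|G_i)$ is defined, $f(D|G_{i+1})\le f(D|G_i)$ for $1\le i<n$, $G_1$ parses some string of $D$, and each $G_{i+1}$ parses some string of $D$ that $G_i$ does not parse. **Learner.** The BFS learner with meta-parameters $m,k\in\mathbb N$, $t\in\mathbb R$ and input $D$ searches the finite sets $v$ of core rules over the nonterminals $X_0,X_1,\dots$. It keeps a frontier $Q$ of pairs $(v,d)$, initially $\{(\emptyset,0)\}$, and a set $O$ of hypotheses, initially empty. In each pass it visits all $(v,d)\in Q$. For every set $A$ of rules $X\to x$, with $X$ occurring in $v$ and $x\in T$, such that $g=v\cup A$ parses some string of $D$, it tests whether $g$ is optimal: $f(D|g)$ is defined and at least $t$, and either $|v|\le m$, or some $g'\in O$ found in an earlier pass satisfies $g'\subseteq g$, $|v|-|\mathrm{core}(g')|\le k$, $f(D|g)\le f(D|g')$, and $g$ parses a string of $D$ that $g'$ does not. Optimal $g$ are added to $O$, and if there is one, $d$ is reset to $0$. Then, if $|v|<m$ or $d<k$, all pairs $(v\cup\{r\},d+1)$ are put into the next frontier, where $r\notin v$ ranges over the core rules with nonterminals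 among the first $3(|v|+1)$ ones (enough up to renaming); otherwise the branch is cut off. The learner halts when the frontier is empty, and outputs $O$. **Theorem.** Let $m,k\in\mathbb N$, $t\in\mathbb R$, let $G\in\mathcal C_{m,k}$ be a target grammar and let $D\subseteq L(G)$ be finite. Assume that $t\le f(D|G)$, and that there is a sequence $G_1,\dots,G_n=G$ as in the definition of $\mathcal C_{m,k}$ that is a non-increasing optimal path for $D$. Then the BFS learner with meta-parameters $m,k,t$ halts on the input $D$, and its output $O$ contains a grammar $h$ with $L(h)=L(G)$ (weak equivalence) that has no more core rules, and no more production rules in total, than $G$ (succinctness). -/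

import Mathlib

/-! Nearly-CNF context-free grammars, their basic strings and fitness, the `(m,k)`-incremental
classes, and the breadth-first learner. -/

/-- Core rules over the nonterminals `V`; the start symbol `S` is not a member of `V`:
`start X` is `S → X` and `binary X Y Z` is `X → Y Z`. -/
inductive CoreRule (V : Type) : Type
  | start (X : V) : CoreRule V
  | binary (X Y Z : V) : CoreRule V

open Classical in
/-- The nonterminals (other than `S`) occurring in a core rule. -/
noncomputable def CoreRule.symbols {V : Type} : CoreRule V → Finset V
  | .start X => {X}
  | .binary X Y Z => {X, Y, Z}

/-- A nonlexicalized context-free grammar in nearly Chomsky normal form: a finite set of core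
rules and a finite set of POS assignment rules `X → x`, the latter written as pairs `(X, x)`. -/
@[ext]
structure PosGrammar (V : Type) (T : Type*) where
  core : Finset (CoreRule V)
  pos : Finset (V × T)

namespace PosGrammar

variable {V : Type} {T : Type*}

/-- A core rule as a context-free rule; `none` is the start symbol `S`. -/
def coreToRule : CoreRule V → ContextFreeRule T (Option V)
  | .start X => ⟨none, [Symbol.nonterminal (some X)]⟩
  | .binary X Y Z => ⟨some X, [Symbol.nonterminal (some Y), Symbol.nonterminal (some Z)]⟩

/-- A POS assignment rule as a context-free rule. -/
def posToRule (r : V × T) : ContextFreeRule T (Option V) :=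
  ⟨some r.1, [Symbol.terminal r.2]⟩

open Classical in
/-- The grammar as a context-free grammar in the usual sense. -/
noncomputable def toCFG (G : PosGrammar V T) : ContextFreeGrammar T where
  NT := Option V
  initial := none
  rules := G.core.image coreToRule ∪ G.pos.image posToRule

/-- The generated language. -/
noncomputable def language (G : PosGrammar V T) : Language T := G.toCFG.language

/-- Inclusion of the sets of production rules. -/
def IsSub (G' G : PosGrammar V T) : Prop := G'.core ⊆ G.core ∧ G'.pos ⊆ G.pos

/-- The total number of production rules. -/
def size (G : PosGrammar V T) : ℕ := G.core.card + G.pos.card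

end PosGrammar

/-- Parse trees below the start symbol. -/
inductive ParseTree (V : Type) (T : Type*)
  | leaf (X : V) (x : T) : ParseTree V T
  | node (X : V) (l r : ParseTree V T) : ParseTree V T

namespace ParseTree

variable {V : Type} {T : Type*}

/-- The nonterminal at the root. -/
def root : ParseTree V T → V
  | leaf X _ => X
  | node X _ _ => X

/-- The string at the leaves. -/
def yield : ParseTree V T → List T
  | leaf _ x => [x]
  | node _ l r => l.yield ++ r.yield

/-- Every node of the tree is an application of a rule of `G`. -/
def Valid (G : PosGrammar V T) : ParseTree V T → Prop
  | leaf X x => (X, x) ∈ G.pos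
  | node X l r => CoreRule.binary X l.root r.root ∈ G.core ∧ l.Valid G ∧ r.Valid G

/-- The nonterminal sequences along the paths from the root to the leaves. -/
def paths : ParseTree V T → List (List V)
  | leaf X _ => [[X]]
  | node X l r => (l.paths ++ r.paths).map (fun p => X :: p)

/-- A tree is basic if no path to a leaf contains more than one recursion: no two
recursions (a nonterminal occurring again further down) follow one another on a path,
i.e. every path splits into two pieces without repeated nonterminals. -/
def IsBasic (t : ParseTree V T) : Prop :=
  ∀ p ∈ t.paths, ∃ a b : List V, p = a ++ b ∧ a.Nodup ∧ b.Nodup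

end ParseTree

namespace PosGrammar

variable {V : Type} {T : Type*}

/-- The set `B_G` of basic strings: strings having some basic parse tree. -/
def basicStrings (G : PosGrammar V T) : Set (List T) :=
  {w | ∃ t : ParseTree V T,
    CoreRule.start t.root ∈ G.core ∧ t.Valid G ∧ t.IsBasic ∧ t.yield = w}

/-- Evidence shape vector: the number of basic strings of `G` of length `i` in the input `D`. -/
noncomputable def evidenceShape (D : Finset (List T)) (G : PosGrammar V T) (i : ℕ) : ℕ :=
  {w : List T | w ∈ D ∧ w ∈ G.basicStrings ∧ w.length = i}.ncard

/-- Grammar shape vector: the number of basic strings of `G` of length `i`. -/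
noncomputable def grammarShape (G : PosGrammar V T) (i : ℕ) : ℕ :=
  {w : List T | w ∈ G.basicStrings ∧ w.length = i}.ncard

/-- The fitness of `G` is defined only if `G` has some basic string. (Only finitely many
entries of a shape vector are nonzero.) -/
def FitnessDefined (G : PosGrammar V T) : Prop := (∑ᶠ i, G.grammarShape i) ≠ 0

/-- The fitness `f(D|G)`. -/
noncomputable def fitness (D : Finset (List T)) (G : PosGrammar V T) : ℝ :=
  ((∑ᶠ i, G.evidenceShape D i : ℕ) : ℝ) / ((∑ᶠ i, G.grammarShape i : ℕ) : ℝ)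

/-- `s` is a sequence of grammars ending in `G` along which rules and languages strictly grow;
it starts within `m` core rules, and each step adds at most `k` core rules. -/
structure IsIncrementalSeq (m k : ℕ) {n : ℕ} (s : Fin (n + 1) → PosGrammar V T)
    (G : PosGrammar V T) : Prop where
  last : s (Fin.last n) = G
  first_card : (s 0).core.card ≤ m
  sub : ∀ i : Fin n, (s i.castSucc).IsSub (s i.succ) ∧ s i.castSucc ≠ s i.succ
  language_lt : ∀ i : Fin n, (s i.castSucc).language < (s i.succ).language
  step_card : ∀ i : Fin n, (s i.succ).core.card ≤ (s i.castSucc).core.card + k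

/-- The class `C_{m,k}` of `(m,k)`-incremental grammars. -/
def incrementalClass (V : Type) (T : Type*) (m k : ℕ) : Set (PosGrammar V T) :=
  {G | ∃ (n : ℕ) (s : Fin (n + 1) → PosGrammar V T), IsIncrementalSeq m k s G}

/-- `s` is a non-increasing optimal path for the input `D`: the fitness is defined and does not
increase along `s`, and the members of `s` parse larger and larger parts of `D`. -/
structure IsNonincreasingPath (D : Finset (List T)) {n : ℕ}
    (s : Fin (n + 1) → PosGrammar V T) : Prop where
  defined : ∀ i, (s i).FitnessDefined
  nonincreasing : ∀ i : Fin n, (s i.succ).fitness D ≤ (s i.castSucc).fitness D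
  first_parses : ∃ w ∈ D, w ∈ (s 0).language
  parses_more : ∀ i : Fin n, ∃ w ∈ D, w ∈ (s i.succ).language ∧ w ∉ (s i.castSucc).language

end PosGrammar

namespace Learner

variable {T : Type*}

/-- A vertex of the lattice: a finite set of core rules over the nonterminals
`X₀, X₁, X₂, …`. -/
abbrev Vertex : Type := Finset (CoreRule ℕ)

open Classical in
/-- All core rules over `X₀, …, X_{n-1}`. -/
noncomputable def rulesBelow (n : ℕ) : Finset (CoreRule ℕ) :=
  (Finset.range n).image CoreRule.start ∪
    (Finset.range n ×ˢ Finset.range n ×ˢ Finset.range n).image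
      (fun p => CoreRule.binary p.1 p.2.1 p.2.2)

open Classical in
/-- Adjacent vertices: one core rule is added. Since a rule has at most three nonterminals, up to
renaming the first `3(|v|+1)` nonterminals suffice for the rules of `v` and one more rule. -/
noncomputable def adjacents (v : Vertex) : Finset Vertex :=
  (rulesBelow (3 * (v.card + 1)) \ v).image (fun r => insert r v)

open Classical in
/-- The candidate POS assignments for `v`: the sets of rules `X → x` with `X` occurring
in `v` which, together with `v`, allow some sentence of the input to be parsed. -/
noncomputable def candidates [Fintype T] (D : Finset (List T)) (v : Vertex) :
    Finset (Finset (ℕ × T)) :=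
  (v.biUnion CoreRule.symbols ×ˢ (Finset.univ : Finset T)).powerset.filter
    (fun A => ∃ w ∈ D, w ∈ (PosGrammar.mk v A).language)

/-- `g` is optimal, given the optimal grammars `O` found so far: its fitness is defined and at
least `t`, and it lies on a non-increasing path, i.e. it is a first optimum within distance
`m` of the empty set, or it extends, by at most `k` core rules, some member of `O` whose
fitness is not smaller, and parses a further sentence of the input. -/
def IsOptimal (D : Finset (List T)) (m k : ℕ) (t : ℝ) (O : Finset (PosGrammar ℕ T))
    (g : PosGrammar ℕ T) : Prop :=
  g.FitnessDefined ∧ t ≤ g.fitness D ∧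
    (g.core.card ≤ m ∨
      ∃ g' ∈ O, g'.IsSub g ∧ g.core.card ≤ g'.core.card + k ∧ g.fitness D ≤ g'.fitness D ∧
        ∃ w ∈ D, w ∈ g.language ∧ w ∉ g'.language)

/-- State of the search: the frontier of pairs `(v, d)`, where `d` is the number of edges since
the last optimum on the way to `v`, and the set of optimal grammars found so far. -/
structure State (T : Type*) where
  frontier : Finset (Vertex × ℕ)
  optima : Finset (PosGrammar ℕ T)

/-- The search starts at the empty set of core rules. -/
def initial (T : Type*) : State T := ⟨{(∅, 0)}, ∅⟩

open Classical in
/-- The optimal grammars found at the vertex `v`. -/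
noncomputable def optimaAt [Fintype T] (D : Finset (List T)) (m k : ℕ) (t : ℝ)
    (O : Finset (PosGrammar ℕ T)) (v : Vertex) : Finset (PosGrammar ℕ T) :=
  ((candidates D v).image (fun A => PosGrammar.mk v A)).filter (IsOptimal D m k t O)

open Classical in
/-- Visiting `(v, d)`: `d` is reset to `0` if an optimal grammar is found at `v`; then the
adjacent vertices are enqueued if `|v| < m` or `d < k`, and the branch is cut off otherwise. -/
noncomputable def expand [Fintype T] (D : Finset (List T)) (m k : ℕ) (t : ℝ)
    (O : Finset (PosGrammar ℕ T)) (q : Vertex × ℕ) : Finset (Vertex × ℕ) :=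
  let d := if (optimaAt D m k t O q.1).Nonempty then 0 else q.2
  if q.1.card < m ∨ d < k then (adjacents q.1).image (fun u => (u, d + 1)) else ∅

open Classical in
/-- One pass of the main loop: all pairs in the current frontier are visited. -/
noncomputable def step [Fintype T] (D : Finset (List T)) (m k : ℕ) (t : ℝ)
    (σ : State T) : State T where
  frontier := σ.frontier.biUnion (expand D m k t σ.optima)
  optima := σ.optima ∪ σ.frontier.biUnion (fun q => optimaAt D m k t σ.optima q.1)

/-- The state after `n` passes of the main loop. -/
noncomputable def run [Fintype T] (D : Finset (List T)) (m k : ℕ) (t : ℝ) (n : ℕ) : State T :=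
  (step D m k t)^[n] (initial T)

/-- The learner with meta-parameters `m, k, t` halts on the input `D`, when the frontier becomes
empty for the first time, and then outputs the set `O` of hypotheses. -/
def Outputs [Fintype T] (D : Finset (List T)) (m k : ℕ) (t : ℝ)
    (O : Finset (PosGrammar ℕ T)) : Prop :=
  ∃ n : ℕ, (run D m k t n).frontier = ∅ ∧ (∀ j < n, (run D m k t j).frontier ≠ ∅) ∧
    (run D m k t n).optima = O

end Learner

/-! The learner can follow any non-increasing optimal path once its nonterminals are suitably named.
List the core rules of `G` so that the cores of `G_1, ..., G_n` are initial segments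
(`Finset.exists_list_of_chain`), and name nonterminals by first occurrence in this list
(`CoreRule.exists_naming`). The first `j` rules then use only names below `3 * j`, so adding the
rules one by one follows edges of the lattice. A renaming that is injective on the occurring
nonterminals transports parse trees both ways, hence preserves language, basic strings and fitness,
and it does not increase the number of rules.

By induction on `j` (`IsSearchPath.search`), pass `j` visits the vertex of the first `j` rules,
every path grammar with fewer than `j` core rules has been found, and the counter `d` is at most the
distance to each of them. The branch survives because consecutive path grammars differ by at most
`k` core rules.

Halting: every optimum heads a chain of optima that parse more and more of `D` at a cost of at most
`k` core rules per link, so it has at most `m + k * |D|` core rules. Beyond that level `d` is never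
reset, and the cut-off ends every branch. -/

namespace CoreRule

/-! ### Renaming of rules and trees -/

variable {V W : Type}

/-- Renaming of the nonterminals of a core rule. -/
def map (f : V → W) : CoreRule V → CoreRule W
  | .start X => .start (f X)
  | .binary X Y Z => .binary (f X) (f Y) (f Z)

/-- The nonterminals of a core rule, as a list. -/
def symbolList : CoreRule V → List V
  | .start X => [X]
  | .binary X Y Z => [X, Y, Z]

theorem mem_symbolList {r : CoreRule V} {X : V} : X ∈ r.symbolList ↔ X ∈ r.symbols := by
  cases r <;> simp [symbolList, symbols]

theorem length_symbolList_le (r : CoreRule V) : r.symbolList.length ≤ 3 := by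
  cases r <;> simp [symbolList]

theorem mem_symbols_map {f : V → W} {r : CoreRule V} {y : W} :
    y ∈ (r.map f).symbols ↔ ∃ x ∈ r.symbols, f x = y := by
  cases r <;> simp [map, symbols, eq_comm]

theorem map_map_of_leftInverse {f : V → W} {g : W → V} {r : CoreRule V}
    (h : ∀ x ∈ r.symbols, g (f x) = x) : (r.map f).map g = r := by
  cases r <;> simp_all [map, symbols]

end CoreRule

namespace ParseTree

variable {V W : Type} {T : Type*}

/-- Renaming of the nonterminals of a parse tree. -/
def map (f : V → W) : ParseTree V T → ParseTree W T
  | leaf X x => leaf (f X) x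
  | node X l r => node (f X) (l.map f) (r.map f)

theorem root_map (f : V → W) (t : ParseTree V T) : (t.map f).root = f t.root := by
  cases t <;> rfl

theorem yield_map (f : V → W) (t : ParseTree V T) : (t.map f).yield = t.yield := by
  induction t with
  | leaf X x => rfl
  | node X l r hl hr => simp [map, yield, hl, hr]

theorem paths_map (f : V → W) (t : ParseTree V T) :
    (t.map f).paths = t.paths.map (List.map f) := by
  induction t with
  | leaf X x => rfl
  | node X l r hl hr => simp [map, paths, hl, hr, Function.comp_def]

end ParseTree

/-! ### Homomorphisms of grammars and their action on parse trees -/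

namespace PosGrammar

variable {V W : Type} {T : Type*}

open Classical in
/-- The nonterminals occurring in the core rules. -/
noncomputable def occurring (G : PosGrammar V T) : Finset V := G.core.biUnion CoreRule.symbols

theorem mem_occurring {G : PosGrammar V T} {X : V} :
    X ∈ G.occurring ↔ ∃ r ∈ G.core, X ∈ r.symbols := by
  simp [occurring]

theorem occurring_of_valid_node {G : PosGrammar V T} {X : V} {l r : ParseTree V T}
    (h : (ParseTree.node X l r).Valid G) : l.root ∈ G.occurring ∧ r.root ∈ G.occurring :=
  ⟨mem_occurring.2 ⟨_, h.1, by simp [CoreRule.symbols]⟩,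
    mem_occurring.2 ⟨_, h.1, by simp [CoreRule.symbols]⟩⟩

/-- Every nonterminal below the root stands in the binary rule applied at its parent. Hence
injectivity on `G.occurring` suffices when trees are renamed. -/
theorem mem_occurring_of_mem_paths {G : PosGrammar V T} {t : ParseTree V T} (ht : t.Valid G)
    (hr : t.root ∈ G.occurring) : ∀ p ∈ t.paths, ∀ X ∈ p, X ∈ G.occurring := by
  induction t with
  | leaf X x => simpa [ParseTree.paths, ParseTree.root] using hr
  | node X l r hl hr' =>
    obtain ⟨h1, h2⟩ := occurring_of_valid_node ht
    intro p hp Y hY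
    simp only [ParseTree.paths, List.mem_map, List.mem_append] at hp
    obtain ⟨q, hq, rfl⟩ := hp
    rcases List.mem_cons.1 hY with rfl | hY
    · exact hr
    · rcases hq with hq | hq
      · exact hl ht.2.1 h1 q hq Y hY
      · exact hr' ht.2.2 h2 q hq Y hY

/-- A parse tree of `G` from the start symbol. -/
def IsParse (G : PosGrammar V T) (t : ParseTree V T) : Prop :=
  CoreRule.start t.root ∈ G.core ∧ t.Valid G

theorem IsParse.root_mem {G : PosGrammar V T} {t : ParseTree V T} (h : G.IsParse t) :
    t.root ∈ G.occurring :=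
  mem_occurring.2 ⟨_, h.1, by simp [CoreRule.symbols]⟩

/-- `f` maps the core rules of `G`, and the useful POS assignment rules, to rules of `H`. -/
structure IsHom (f : V → W) (G : PosGrammar V T) (H : PosGrammar W T) : Prop where
  core : ∀ r ∈ G.core, r.map f ∈ H.core
  pos : ∀ X ∈ G.occurring, ∀ x, (X, x) ∈ G.pos → (f X, x) ∈ H.pos

theorem IsHom.valid_map {f : V → W} {G : PosGrammar V T} {H : PosGrammar W T}
    (hf : IsHom f G H) {t : ParseTree V T} (ht : t.Valid G) (hr : t.root ∈ G.occurring) :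
    (t.map f).Valid H := by
  induction t with
  | leaf X x => exact hf.pos X hr x ht
  | node X l r hl hr' =>
    obtain ⟨h1, h2⟩ := occurring_of_valid_node ht
    refine ⟨?_, hl ht.2.1 h1, hr' ht.2.2 h2⟩
    simpa [ParseTree.root_map, CoreRule.map] using hf.core _ ht.1

theorem IsHom.isParse_map {f : V → W} {G : PosGrammar V T} {H : PosGrammar W T}
    (hf : IsHom f G H) {t : ParseTree V T} (ht : G.IsParse t) : H.IsParse (t.map f) :=
  ⟨by simpa [ParseTree.root_map, CoreRule.map] using hf.core _ ht.1,
    hf.valid_map ht.2 ht.root_mem⟩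

/-- Injectivity keeps the two pieces of a path free of repetitions; identifying nonterminals could
create new recursions. -/
theorem isBasic_map {f : V → W} {G : PosGrammar V T} (hf : Set.InjOn f G.occurring)
    {t : ParseTree V T} (ht : G.IsParse t) (hb : t.IsBasic) : (t.map f).IsBasic := by
  intro p hp
  rw [ParseTree.paths_map, List.mem_map] at hp
  obtain ⟨q, hq, rfl⟩ := hp
  have hocc := mem_occurring_of_mem_paths ht.2 ht.root_mem q hq
  obtain ⟨a, b, rfl, ha, hb⟩ := hb q hq
  refine ⟨a.map f, b.map f, by simp, ha.map_on ?_, hb.map_on ?_⟩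
  · exact fun x hx y hy h => hf (hocc x (by simp [hx])) (hocc y (by simp [hy])) h
  · exact fun x hx y hy h => hf (hocc x (by simp [hx])) (hocc y (by simp [hy])) h

theorem IsHom.basicStrings_subset {f : V → W} {G : PosGrammar V T} {H : PosGrammar W T}
    (hf : IsHom f G H) (hi : Set.InjOn f G.occurring) : G.basicStrings ⊆ H.basicStrings := by
  rintro w ⟨t, h1, h2, h3, rfl⟩
  have := hf.isParse_map ⟨h1, h2⟩
  exact ⟨t.map f, this.1, this.2, isBasic_map hi ⟨h1, h2⟩ h3, t.yield_map f⟩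

/-! ### Parse trees and derivations -/

theorem coreToRule_mem {G : PosGrammar V T} {r : CoreRule V} (h : r ∈ G.core) :
    coreToRule r ∈ G.toCFG.rules := by
  classical
  exact Finset.mem_union_left _ (Finset.mem_image_of_mem _ h)

theorem posToRule_mem {G : PosGrammar V T} {r : V × T} (h : r ∈ G.pos) :
    posToRule r ∈ G.toCFG.rules := by
  classical
  exact Finset.mem_union_right _ (Finset.mem_image_of_mem _ h)

theorem produces_of_mem {G : PosGrammar V T} {r : ContextFreeRule T (Option V)}
    (h : r ∈ G.toCFG.rules) : G.toCFG.Produces [.nonterminal r.input] r.output :=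
  ⟨r, h, ContextFreeRule.Rewrites.input_output⟩

theorem derives_yield {G : PosGrammar V T} {t : ParseTree V T} (ht : t.Valid G) :
    G.toCFG.Derives [.nonterminal (some t.root)] (t.yield.map Symbol.terminal) := by
  induction t with
  | leaf X x => exact (produces_of_mem (posToRule_mem ht)).single
  | node X l r hl hr =>
    refine (produces_of_mem (coreToRule_mem ht.1)).trans_derives ?_
    have h1 := (hl ht.2.1).append_right [.nonterminal (some r.root)]
    have h2 := (hr ht.2.2).append_left (l.yield.map Symbol.terminal)
    rw [← List.map_append] at h2
    exact h1.trans h2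

/-- The strings which parse trees assign to a grammar symbol. -/
def SymbolYields (G : PosGrammar V T) : Symbol T (Option V) → List T → Prop
  | .terminal x, w => w = [x]
  | .nonterminal none, w => ∃ t, G.IsParse t ∧ t.yield = w
  | .nonterminal (some X), w => ∃ t : ParseTree V T, t.Valid G ∧ t.root = X ∧ t.yield = w

/-- A production is undone by joining the trees of its right-hand side under a new node. -/
theorem symbolYields_of_rule {G : PosGrammar V T} {r : ContextFreeRule T (Option V)}
    (hr : r ∈ G.toCFG.rules) {ws : List (List T)}
    (h : List.Forall₂ G.SymbolYields r.output ws) :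
    G.SymbolYields (.nonterminal r.input) ws.flatten := by
  classical
  rcases Finset.mem_union.1 hr with hr | hr
  · obtain ⟨c, hc, rfl⟩ := Finset.mem_image.1 hr
    cases c with
    | start X =>
      simp only [coreToRule, List.forall₂_cons_left_iff, List.forall₂_nil_left_iff] at h
      obtain ⟨w, u, ⟨t, ht, rfl, rfl⟩, rfl, rfl⟩ := h
      exact ⟨t, ⟨hc, ht⟩, by simp⟩
    | binary X Y Z =>
      simp only [coreToRule, List.forall₂_cons_left_iff, List.forall₂_nil_left_iff] at h
      obtain ⟨w, u, ⟨t, ht, rfl, rfl⟩, ⟨w', u', ⟨t', ht', rfl, rfl⟩, rfl, rfl⟩, rfl⟩ := h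
      exact ⟨.node X t t', ⟨hc, ht, ht'⟩, rfl, by simp [ParseTree.yield]⟩
  · obtain ⟨⟨X, x⟩, hp, rfl⟩ := Finset.mem_image.1 hr
    simp only [posToRule, List.forall₂_cons_left_iff, List.forall₂_nil_left_iff] at h
    obtain ⟨w, u, rfl, rfl, rfl⟩ := h
    exact ⟨.leaf X x, hp, rfl, rfl⟩

theorem _root_.List.exists_of_forall₂_append_left {α β : Type*} {R : α → β → Prop}
    {l₁ l₂ : List α} {u : List β} (h : List.Forall₂ R (l₁ ++ l₂) u) :
    ∃ u₁ u₂, List.Forall₂ R l₁ u₁ ∧ List.Forall₂ R l₂ u₂ ∧ u = u₁ ++ u₂ := by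
  induction l₁ generalizing u with
  | nil => exact ⟨[], u, .nil, h, rfl⟩
  | cons a l ih =>
    obtain ⟨b, u, hb, hu, rfl⟩ := List.forall₂_cons_left_iff.1 h
    obtain ⟨u₁, u₂, h1, h2, rfl⟩ := ih hu
    exact ⟨b :: u₁, u₂, .cons hb h1, h2, rfl⟩

/-- Induction backwards from the terminal string: the strings assigned to the output of the
rewritten symbol are merged into one string for that symbol. -/
theorem exists_symbolYields_of_derives {G : PosGrammar V T} {s : List (Symbol T (Option V))}
    {w : List T} (h : G.toCFG.Derives s (w.map Symbol.terminal)) :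
    ∃ ws, List.Forall₂ G.SymbolYields s ws ∧ ws.flatten = w := by
  induction h using Relation.ReflTransGen.head_induction_on with
  | refl =>
    refine ⟨w.map fun x => [x], ?_, by induction w <;> simp_all⟩
    induction w with
    | nil => exact .nil
    | cons x w ih => exact .cons rfl ih
  | head h _ ih =>
    obtain ⟨r, hr, h⟩ := h
    obtain ⟨p, q, rfl, rfl⟩ := h.exists_parts
    obtain ⟨ws, hws, rfl⟩ := ih
    rw [List.append_assoc] at hws
    obtain ⟨w1, w23, h1, h23, rfl⟩ := List.exists_of_forall₂_append_left hws
    obtain ⟨w2, w3, h2, h3, rfl⟩ := List.exists_of_forall₂_append_left h23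
    refine ⟨w1 ++ (w2.flatten :: w3), ?_, by simp⟩
    rw [List.append_assoc]
    exact List.rel_append h1 (.cons (symbolYields_of_rule hr h2) h3)

theorem mem_language_iff {G : PosGrammar V T} {w : List T} :
    w ∈ G.language ↔ ∃ t, G.IsParse t ∧ t.yield = w := by
  constructor
  · intro h
    obtain ⟨ws, hws, rfl⟩ := exists_symbolYields_of_derives (G := G) h
    obtain ⟨u, v, hu, hv, rfl⟩ := List.forall₂_cons_left_iff.1 hws
    obtain rfl := List.forall₂_nil_left_iff.1 hv
    simpa [toCFG, SymbolYields] using hu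
  · rintro ⟨t, ht, rfl⟩
    exact (produces_of_mem (coreToRule_mem ht.1)).trans_derives (derives_yield ht.2)

theorem IsHom.language_le {f : V → W} {G : PosGrammar V T} {H : PosGrammar W T}
    (hf : IsHom f G H) {w : List T} (hw : w ∈ G.language) : w ∈ H.language := by
  obtain ⟨t, ht, rfl⟩ := mem_language_iff.1 hw
  exact mem_language_iff.2 ⟨t.map f, hf.isParse_map ht, t.yield_map f⟩

theorem coreRule_map_id (r : CoreRule V) : r.map id = r := by cases r <;> rfl

theorem IsSub.language_le {G H : PosGrammar V T} (h : G.IsSub H) {w : List T}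
    (hw : w ∈ G.language) : w ∈ H.language := by
  refine IsHom.language_le (f := id) ⟨fun r hr => ?_, fun X _ x hx => h.2 hx⟩ hw
  rw [coreRule_map_id]
  exact h.1 hr

theorem IsSub.refl (G : PosGrammar V T) : G.IsSub G := ⟨subset_rfl, subset_rfl⟩

theorem IsSub.trans {G H K : PosGrammar V T} (h : G.IsSub H) (h' : H.IsSub K) : G.IsSub K :=
  ⟨h.1.trans h'.1, h.2.trans h'.2⟩

theorem isSub_of_le {p : ℕ → PosGrammar V T} {b : ℕ} (h : ∀ i < b, (p i).IsSub (p (i + 1)))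
    {a : ℕ} (hab : a ≤ b) : (p a).IsSub (p b) := by
  induction b, hab using Nat.le_induction with
  | base => exact IsSub.refl _
  | succ b _ ih => exact (ih fun i hi => h i (by omega)).trans (h b (by omega))

theorem IsSub.occurring_subset {G H : PosGrammar V T} (h : G.IsSub H) :
    G.occurring ⊆ H.occurring := by
  classical
  exact Finset.biUnion_subset_biUnion_of_subset_left _ h.1

/-! ### Renaming -/

open Classical in
/-- Renaming of the nonterminals; POS assignment rules for nonterminals which do not occur in
the core are dropped. -/
noncomputable def rename (f : V → W) (G : PosGrammar V T) : PosGrammar W T where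
  core := G.core.image (CoreRule.map f)
  pos := (G.pos.filter fun p => p.1 ∈ G.occurring).image fun p => (f p.1, p.2)

theorem isHom_rename (f : V → W) (G : PosGrammar V T) : IsHom f G (G.rename f) := by
  classical
  refine ⟨fun r hr => Finset.mem_image_of_mem _ hr, fun X hX x hx => ?_⟩
  exact Finset.mem_image.2 ⟨(X, x), Finset.mem_filter.2 ⟨hx, hX⟩, rfl⟩

theorem mem_occurring_rename {f : V → W} {G : PosGrammar V T} {y : W} :
    y ∈ (G.rename f).occurring ↔ ∃ x ∈ G.occurring, f x = y := by
  simp only [mem_occurring, rename, Finset.mem_image, exists_exists_and_eq_and,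
    CoreRule.mem_symbols_map]
  grind

/-- With `isHom_rename` this gives homomorphisms in both directions, from which the invariance of
language and basic strings follows. -/
theorem isHom_of_leftInverse {f : V → W} {g : W → V} {G : PosGrammar V T}
    (h : ∀ x ∈ G.occurring, g (f x) = x) : IsHom g (G.rename f) G := by
  classical
  constructor
  · intro r hr
    obtain ⟨r, hr', rfl⟩ := Finset.mem_image.1 hr
    rw [CoreRule.map_map_of_leftInverse fun x hx => h x (mem_occurring.2 ⟨r, hr', hx⟩)]
    exact hr'
  · intro X _ x hx
    obtain ⟨⟨Y, y⟩, hp, he⟩ := Finset.mem_image.1 hx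
    obtain ⟨hp, hY⟩ := Finset.mem_filter.1 hp
    cases he
    simpa [h Y hY] using hp

theorem injOn_of_leftInverse {f : V → W} {g : W → V} {G : PosGrammar V T}
    (h : ∀ x ∈ G.occurring, g (f x) = x) : Set.InjOn g (G.rename f).occurring := by
  intro y hy z hz e
  obtain ⟨y, hy', rfl⟩ := mem_occurring_rename.1 hy
  obtain ⟨z, hz', rfl⟩ := mem_occurring_rename.1 hz
  rw [h y hy', h z hz'] at e
  rw [e]

theorem exists_leftInverse [Nonempty V] {f : V → W} {G : PosGrammar V T}
    (hf : Set.InjOn f G.occurring) : ∃ g : W → V, ∀ x ∈ G.occurring, g (f x) = x :=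
  ⟨Function.invFunOn f G.occurring, fun _ hx => hf.leftInvOn_invFunOn hx⟩

theorem language_rename [Nonempty V] {f : V → W} {G : PosGrammar V T}
    (hf : Set.InjOn f G.occurring) : (G.rename f).language = G.language := by
  obtain ⟨g, hg⟩ := exists_leftInverse hf
  ext w
  exact ⟨(isHom_of_leftInverse hg).language_le, (isHom_rename f G).language_le⟩

theorem basicStrings_rename [Nonempty V] {f : V → W} {G : PosGrammar V T}
    (hf : Set.InjOn f G.occurring) : (G.rename f).basicStrings = G.basicStrings := by
  obtain ⟨g, hg⟩ := exists_leftInverse hf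
  exact ((isHom_of_leftInverse hg).basicStrings_subset (injOn_of_leftInverse hg)).antisymm
    ((isHom_rename f G).basicStrings_subset hf)

theorem fitnessDefined_rename [Nonempty V] {f : V → W} {G : PosGrammar V T}
    (hf : Set.InjOn f G.occurring) : (G.rename f).FitnessDefined ↔ G.FitnessDefined := by
  simp only [FitnessDefined, grammarShape, basicStrings_rename hf]

theorem fitness_rename [Nonempty V] {f : V → W} {G : PosGrammar V T}
    (hf : Set.InjOn f G.occurring) (D : Finset (List T)) :
    (G.rename f).fitness D = G.fitness D := by
  simp only [fitness, grammarShape, evidenceShape, basicStrings_rename hf]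

theorem IsSub.rename {G H : PosGrammar V T} (h : G.IsSub H) (f : V → W) :
    (G.rename f).IsSub (H.rename f) := by
  classical
  refine ⟨Finset.image_subset_image h.1, Finset.image_subset_image fun p hp => ?_⟩
  rw [Finset.mem_filter] at hp ⊢
  exact ⟨h.2 hp.1, h.occurring_subset hp.2⟩

theorem injOn_coreRule_map [Nonempty V] {f : V → W} {G : PosGrammar V T}
    (hf : Set.InjOn f G.occurring) : Set.InjOn (CoreRule.map f) G.core := by
  obtain ⟨g, hg⟩ := exists_leftInverse hf
  refine Set.LeftInvOn.injOn (f₁' := CoreRule.map g) fun r hr => ?_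
  exact CoreRule.map_map_of_leftInverse fun x hx => hg x (mem_occurring.2 ⟨r, hr, hx⟩)

theorem card_core_rename_le (f : V → W) (G : PosGrammar V T) :
    (G.rename f).core.card ≤ G.core.card := by
  classical
  exact Finset.card_image_le

theorem size_rename_le (f : V → W) (G : PosGrammar V T) : (G.rename f).size ≤ G.size := by
  classical
  exact Nat.add_le_add (card_core_rename_le f G)
    (Finset.card_image_le.trans (Finset.card_filter_le _ _))

/-- The learner tries POS rules only for nonterminals occurring in the vertex; `rename` drops the
others so that its result is a candidate. -/
theorem pos_rename_subset [Fintype T] (f : V → W) (G : PosGrammar V T) :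
    (G.rename f).pos ⊆ (G.rename f).occurring ×ˢ Finset.univ := by
  classical
  intro p hp
  obtain ⟨q, hq, rfl⟩ := Finset.mem_image.1 hp
  simpa using mem_occurring_rename.2 ⟨q.1, (Finset.mem_filter.1 hq).2, rfl⟩

end PosGrammar

/-! ### Enumeration of the rules and names of the nonterminals -/

/-- The members of an increasing chain of finite sets are initial segments of one list. -/
theorem Finset.exists_list_of_chain {α : Type*} [DecidableEq α] (c : ℕ → Finset α)
    (hc : Monotone c) (n : ℕ) :
    ∃ l : List α, l.Nodup ∧ l.toFinset = c n ∧
      ∀ i ≤ n, (l.take (c i).card).toFinset = c i := by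
  induction n with
  | zero =>
    refine ⟨(c 0).toList, (c 0).nodup_toList, by simp, fun i hi => ?_⟩
    obtain rfl : i = 0 := by omega
    rw [List.take_of_length_le (by simp)]
    simp
  | succ n ih =>
    obtain ⟨l, hn, hl, hi⟩ := ih
    have hlen : l.length = (c n).card := by rw [← hl, List.toFinset_card_of_nodup hn]
    -- New elements are appended at the end, so the earlier prefixes survive.
    have hfull : (l ++ (c (n + 1) \ c n).toList).toFinset = c (n + 1) := by
      rw [List.toFinset_append, hl, Finset.toList_toFinset]
      exact Finset.union_sdiff_of_subset (hc n.le_succ)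
    have hnodup : (l ++ (c (n + 1) \ c n).toList).Nodup := by
      refine hn.append (Finset.nodup_toList _) fun x hx hx' => ?_
      rw [Finset.mem_toList, Finset.mem_sdiff, ← hl] at hx'
      exact hx'.2 (List.mem_toFinset.2 hx)
    refine ⟨_, hnodup, hfull, fun i hi' => ?_⟩
    rcases hi'.eq_or_lt with rfl | hlt
    · rw [List.take_of_length_le, hfull]
      rw [← List.toFinset_card_of_nodup hnodup, hfull]
    · have hin : i ≤ n := by omega
      rw [List.take_append_of_le_length, hi i hin]
      rw [hlen]
      exact Finset.card_le_card (hc hin)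

/-- The nonterminals of a list of rules have names such that those of the first `j` rules are
among the first `3 * j` ones. -/
theorem CoreRule.exists_naming {V : Type} (l : List (CoreRule V)) :
    ∃ f : V → ℕ, (∀ r ∈ l, ∀ r' ∈ l, ∀ X ∈ r.symbols, ∀ Y ∈ r'.symbols, f X = f Y → X = Y) ∧
      ∀ j, ∀ r ∈ l.take j, ∀ X ∈ r.symbols, f X < 3 * j := by
  classical
  -- The name is the position of the first occurrence; each rule contributes at most three
  -- positions.
  refine ⟨fun X => (l.flatMap CoreRule.symbolList).idxOf X, ?_, ?_⟩
  · intro r hr r' _ X hX Y _ h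
    exact (List.idxOf_inj (List.mem_flatMap.2 ⟨r, hr, mem_symbolList.2 hX⟩)).1 h
  · intro j r hr X hX
    have hmem : X ∈ (l.take j).flatMap CoreRule.symbolList :=
      List.mem_flatMap.2 ⟨r, hr, mem_symbolList.2 hX⟩
    have hlen : ((l.take j).flatMap CoreRule.symbolList).length ≤ 3 * j := by
      rw [List.length_flatMap]
      have := List.sum_le_card_nsmul ((l.take j).map fun r => r.symbolList.length) 3 (by
        intro x hx
        obtain ⟨r, -, rfl⟩ := List.mem_map.1 hx
        exact r.length_symbolList_le)
      simp only [List.length_map, List.length_take, smul_eq_mul] at this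
      have h2 : min j l.length ≤ j := min_le_left _ _
      omega
    have heq : l.flatMap CoreRule.symbolList =
        (l.take j).flatMap CoreRule.symbolList ++ (l.drop j).flatMap CoreRule.symbolList := by
      rw [← List.flatMap_append, List.take_append_drop]
    simp only [heq]
    rw [List.idxOf_append_of_mem hmem]
    exact (List.idxOf_lt_length_iff.2 hmem).trans_le hlen

/-! ### The search in terms of membership -/

namespace Learner

variable {T : Type*} [Fintype T] {D : Finset (List T)} {m k : ℕ} {t : ℝ}

theorem card_of_mem_adjacents {u v : Vertex} (h : u ∈ adjacents v) : u.card = v.card + 1 := by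
  classical
  obtain ⟨r, hr, rfl⟩ := Finset.mem_image.1 h
  convert Finset.card_insert_of_notMem (Finset.mem_sdiff.1 hr).2

theorem mem_rulesBelow {n : ℕ} {r : CoreRule ℕ} (h : ∀ X ∈ r.symbols, X < n) :
    r ∈ rulesBelow n := by
  cases r <;> simp_all [rulesBelow, CoreRule.symbols]

theorem mem_optimaAt {O : Finset (PosGrammar ℕ T)} {v : Vertex} {g : PosGrammar ℕ T} :
    g ∈ optimaAt D m k t O v ↔ g.core = v ∧ g.pos ⊆ g.occurring ×ˢ Finset.univ ∧
      (∃ w ∈ D, w ∈ g.language) ∧ IsOptimal D m k t O g := by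
  classical
  simp only [optimaAt, candidates, Finset.mem_filter, Finset.mem_image, Finset.mem_powerset]
  constructor
  · rintro ⟨⟨A, ⟨hA, hw⟩, rfl⟩, ho⟩
    refine ⟨rfl, ?_, hw, ho⟩
    -- The two unions differ only in their decidability instances.
    convert hA using 2
    simp only [PosGrammar.occurring]
    congr!
  · rintro ⟨rfl, hA, hw, ho⟩
    refine ⟨⟨g.pos, ⟨?_, hw⟩, rfl⟩, ho⟩
    convert hA using 2
    simp only [PosGrammar.occurring]
    congr!

theorem run_succ (n : ℕ) : run D m k t (n + 1) = step D m k t (run D m k t n) :=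
  Function.iterate_succ_apply' _ _ _

theorem mem_frontier_succ {n : ℕ} {q : Vertex × ℕ} :
    q ∈ (run D m k t (n + 1)).frontier ↔
      ∃ p ∈ (run D m k t n).frontier, q ∈ expand D m k t (run D m k t n).optima p := by
  classical
  rw [run_succ]
  simp [step]

theorem mem_optima_succ {n : ℕ} {g : PosGrammar ℕ T} :
    g ∈ (run D m k t (n + 1)).optima ↔ g ∈ (run D m k t n).optima ∨
      ∃ p ∈ (run D m k t n).frontier, g ∈ optimaAt D m k t (run D m k t n).optima p.1 := by
  classical
  rw [run_succ]
  simp [step]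

theorem optima_mono : Monotone fun n => (run D m k t n).optima :=
  monotone_nat_of_le_succ fun _ _ hg => mem_optima_succ.2 (Or.inl hg)

theorem frontier_eq_empty_of_le {i j : ℕ} (hij : i ≤ j) (h : (run D m k t i).frontier = ∅) :
    (run D m k t j).frontier = ∅ := by
  induction j, hij using Nat.le_induction with
  | base => exact h
  | succ j _ ih =>
    refine Finset.eq_empty_of_forall_notMem fun q hq => ?_
    obtain ⟨p, hp, -⟩ := mem_frontier_succ.1 hq
    simp [ih] at hp

/-- The members of the set returned by `expand`. -/
theorem mem_expand {O : Finset (PosGrammar ℕ T)} {q p : Vertex × ℕ} :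
    p ∈ expand D m k t O q ↔ ∃ d, ((optimaAt D m k t O q.1).Nonempty ∧ d = 0 ∨
      ¬(optimaAt D m k t O q.1).Nonempty ∧ d = q.2) ∧ (q.1.card < m ∨ d < k) ∧
        p.1 ∈ adjacents q.1 ∧ p.2 = d + 1 := by
  classical
  obtain ⟨u, e⟩ := p
  by_cases h : (optimaAt D m k t O q.1).Nonempty
  · by_cases h' : q.1.card < m ∨ 0 < k <;> simp [expand, h, h', eq_comm]
  · by_cases h' : q.1.card < m ∨ q.2 < k <;> simp [expand, h, h', eq_comm]

/-! ### Halting -/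

theorem card_of_mem_frontier {n : ℕ} {q : Vertex × ℕ}
    (hq : q ∈ (run D m k t n).frontier) : q.1.card = n := by
  induction n generalizing q with
  | zero =>
    obtain rfl : q = (∅, 0) := by simpa [run, initial] using hq
    rfl
  | succ n ih =>
    obtain ⟨p, hp, hq⟩ := mem_frontier_succ.1 hq
    obtain ⟨d, -, -, h, -⟩ := mem_expand.1 hq
    rw [card_of_mem_adjacents h, ih hp]

-- Each link of the chain of optima adds at most `k` core rules and at least one parsed sentence of
-- `D`, so the parsed sentences pay for the core rules.
open Classical in
theorem card_core_le_of_mem_optima {n : ℕ} {g : PosGrammar ℕ T}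
    (hg : g ∈ (run D m k t n).optima) :
    g.core.card ≤ m + k * (D.filter (· ∈ g.language)).card := by
  induction n generalizing g with
  | zero => simp [run, initial] at hg
  | succ n ih =>
    rcases mem_optima_succ.1 hg with hg | ⟨p, -, hg⟩
    · exact ih hg
    · obtain ⟨-, -, -, -, -, h | ⟨g', hg', hsub, hk, -, w, hwD, hw, hw'⟩⟩ := mem_optimaAt.1 hg
      · omega
      · have hlt : (D.filter (· ∈ g'.language)).card < (D.filter (· ∈ g.language)).card := by
          refine Finset.card_lt_card ((Finset.ssubset_iff_of_subset ?_).2 ⟨w, ?_, ?_⟩)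
          · exact Finset.monotone_filter_right _ fun _ _ h => hsub.language_le h
          · simp [hwD, hw]
          · simp [hw']
        have := ih hg'
        have := Nat.mul_le_mul_left k (Nat.succ_le_of_lt hlt)
        rw [Nat.mul_succ] at this
        omega

theorem card_le_of_optimaAt_nonempty {n : ℕ} {q : Vertex × ℕ}
    (hq : q ∈ (run D m k t n).frontier)
    (h : (optimaAt D m k t (run D m k t n).optima q.1).Nonempty) : n ≤ m + k * D.card := by
  classical
  obtain ⟨g, hg⟩ := h
  have h1 := card_core_le_of_mem_optima (mem_optima_succ.2 (Or.inr ⟨q, hq, hg⟩))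
  rw [(mem_optimaAt.1 hg).1, card_of_mem_frontier hq] at h1
  exact h1.trans (Nat.add_le_add_left (Nat.mul_le_mul_left k (Finset.card_filter_le _ _)) m)

/-- Between resets `d` grows with the level, and resets occur only up to level `m + k * D.card`. The
second part is the cut-off test passed by the parent. -/
theorem bounds_of_mem_frontier {n : ℕ} {q : Vertex × ℕ}
    (hq : q ∈ (run D m k t n).frontier) :
    n ≤ m + k * D.card + q.2 ∧ (n ≤ m ∨ q.2 ≤ k) := by
  induction n generalizing q with
  | zero => simp
  | succ n ih =>
    obtain ⟨p, hp, hq⟩ := mem_frontier_succ.1 hq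
    obtain ⟨d, hd, hlt, -, h2⟩ := mem_expand.1 hq
    have hc := card_of_mem_frontier hp
    have := (ih hp).1
    refine ⟨?_, by omega⟩
    rcases hd with ⟨h, rfl⟩ | ⟨-, rfl⟩
    · have := card_le_of_optimaAt_nonempty hp h
      omega
    · omega

theorem exists_frontier_eq_empty : ∃ n, (run D m k t n).frontier = ∅ := by
  -- At this level, which exceeds `m`, the two bounds would give `k + 1 ≤ q.2` and `q.2 ≤ k`.
  refine ⟨m + k * D.card + k + 1, Finset.eq_empty_of_forall_notMem fun q hq => ?_⟩
  obtain ⟨h1, h2⟩ := bounds_of_mem_frontier hq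
  generalize k * D.card = a at *
  omega

theorem exists_outputs (D : Finset (List T)) (m k : ℕ) (t : ℝ) :
    ∃ O, Outputs D m k t O ∧ ∀ n, (run D m k t n).frontier.Nonempty →
      (run D m k t (n + 1)).optima ⊆ O := by
  classical
  have h := exists_frontier_eq_empty (D := D) (m := m) (k := k) (t := t)
  refine ⟨_, ⟨Nat.find h, Nat.find_spec h, fun j hj => Nat.find_min h hj, rfl⟩, fun n hn => ?_⟩
  refine optima_mono (Nat.succ_le_of_lt (lt_of_not_ge fun hle => ?_))
  exact hn.ne_empty (frontier_eq_empty_of_le hle (Nat.find_spec h))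

/-! ### Completeness of the search -/

/-- A path of vertices in the lattice, together with a non-increasing path of grammars on it. -/
structure IsSearchPath (D : Finset (List T)) (m k : ℕ) (t : ℝ) (n : ℕ) (v : ℕ → Vertex)
    (g : ℕ → PosGrammar ℕ T) : Prop where
  zero : v 0 = ∅
  adjacent : ∀ j < (g n).core.card, v (j + 1) ∈ adjacents (v j)
  core_eq : ∀ i ≤ n, v (g i).core.card = (g i).core
  pos_subset : ∀ i ≤ n, (g i).pos ⊆ (g i).occurring ×ˢ Finset.univ
  sub : ∀ i < n, (g i).IsSub (g (i + 1))
  defined : ∀ i ≤ n, (g i).FitnessDefined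
  nonincreasing : ∀ i < n, (g (i + 1)).fitness D ≤ (g i).fitness D
  threshold : t ≤ (g n).fitness D
  first_parses : ∃ w ∈ D, w ∈ (g 0).language
  parses_more : ∀ i < n, ∃ w ∈ D, w ∈ (g (i + 1)).language ∧ w ∉ (g i).language
  first_card : (g 0).core.card ≤ m
  step_card : ∀ i < n, (g (i + 1)).core.card ≤ (g i).core.card + k

theorem exists_crossing (c : ℕ → ℕ) {j i : ℕ} (h0 : c 0 ≤ j) (hi : j < c i) :
    ∃ a < i, c a ≤ j ∧ j < c (a + 1) := by
  induction i with
  | zero => omega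
  | succ i ih =>
    by_cases h : j < c i
    · obtain ⟨a, ha, h⟩ := ih h
      exact ⟨a, by omega, h⟩
    · exact ⟨i, by omega, by omega, hi⟩

namespace IsSearchPath

variable {n : ℕ} {v : ℕ → Vertex} {g : ℕ → PosGrammar ℕ T}

theorem sub_of_le (h : IsSearchPath D m k t n v g) {a b : ℕ} (hab : a ≤ b) (hb : b ≤ n) :
    (g a).IsSub (g b) :=
  PosGrammar.isSub_of_le (fun i hi => h.sub i (by omega)) hab

theorem card_le_of_le (h : IsSearchPath D m k t n v g) {a b : ℕ} (hab : a ≤ b) (hb : b ≤ n) :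
    (g a).core.card ≤ (g b).core.card :=
  Finset.card_le_card (h.sub_of_le hab hb).1

theorem fitness_le_of_le (h : IsSearchPath D m k t n v g) {a b : ℕ} (hab : a ≤ b)
    (hb : b ≤ n) : (g b).fitness D ≤ (g a).fitness D := by
  induction b, hab using Nat.le_induction with
  | base => exact le_rfl
  | succ b _ ih => exact (h.nonincreasing b (by omega)).trans (ih (by omega))

/-- A grammar of the path is recognized as optimal when its vertex is visited, if the grammars
with fewer core rules have been found. -/
theorem mem_optimaAt (h : IsSearchPath D m k t n v g) {O : Finset (PosGrammar ℕ T)} {i : ℕ}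
    (hi : i ≤ n) (hO : ∀ a ≤ n, (g a).core.card < (g i).core.card → g a ∈ O) :
    g i ∈ optimaAt D m k t O (g i).core := by
  refine Learner.mem_optimaAt.2 ⟨rfl, h.pos_subset i hi, ?_, h.defined i hi,
    h.threshold.trans (h.fitness_le_of_le hi le_rfl), ?_⟩
  · obtain ⟨w, hw, hw'⟩ := h.first_parses
    exact ⟨w, hw, (h.sub_of_le i.zero_le hi).language_le hw'⟩
  · by_cases hm : (g i).core.card ≤ m
    · exact Or.inl hm
    · have h0 := h.first_card
      -- Consecutive grammars may share their core and are then found in the same pass, so `g (i -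
      -- 1)` need not be in `O`. The witness is the grammar `g a` just before the core size of `g i`
      -- is reached: `g (a + 1)` and `g i` have equally many core rules.
      obtain ⟨a, hai, h1, h2⟩ := exists_crossing (fun a => (g a).core.card)
        (j := (g i).core.card - 1) (i := i) (by omega) (by omega)
      have hk := h.step_card a (by omega)
      have heq := h.card_le_of_le (show a + 1 ≤ i by omega) hi
      obtain ⟨w, hwD, hw, hw'⟩ := h.parses_more a (by omega)
      exact Or.inr ⟨g a, hO a (by omega) (by omega), h.sub_of_le hai.le hi, by omega,
        h.fitness_le_of_le hai.le hi, w, hwD,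
        (h.sub_of_le (show a + 1 ≤ i by omega) hi).language_le hw, hw'⟩

/-- The bound on `d` is an inequality because optima off the path may also reset the counter, which
only helps. -/
theorem search (h : IsSearchPath D m k t n v g) {j : ℕ} (hj : j ≤ (g n).core.card) :
    (∃ d, (v j, d) ∈ (run D m k t j).frontier ∧
      ∀ i ≤ n, (g i).core.card < j → d + (g i).core.card ≤ j) ∧
    ∀ i ≤ n, (g i).core.card < j → g i ∈ (run D m k t j).optima := by
  induction j with
  | zero => exact ⟨⟨0, by simp [h.zero, run, initial], by simp⟩, by simp⟩
  | succ j ih =>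
    obtain ⟨⟨d, hd, hdist⟩, hO⟩ := ih (by omega)
    have hopt : ∀ i ≤ n, (g i).core.card = j →
        g i ∈ optimaAt D m k t (run D m k t j).optima (v j) := by
      rintro i hi rfl
      rw [h.core_eq i hi]
      exact h.mem_optimaAt hi hO
    constructor
    -- `e` is the counter after the possible reset; without a reset, no path grammar has exactly `j`
    -- core rules.
    · obtain ⟨e, he, hed⟩ : ∃ e, ((optimaAt D m k t (run D m k t j).optima (v j)).Nonempty ∧
          e = 0 ∨ ¬(optimaAt D m k t (run D m k t j).optima (v j)).Nonempty ∧ e = d) ∧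
          (e = 0 ∨ e = d ∧ ∀ i ≤ n, (g i).core.card ≠ j) := by
        by_cases hne : (optimaAt D m k t (run D m k t j).optima (v j)).Nonempty
        · exact ⟨0, Or.inl ⟨hne, rfl⟩, Or.inl rfl⟩
        · exact ⟨d, Or.inr ⟨hne, rfl⟩, Or.inr ⟨rfl, fun i hi hc => hne ⟨_, hopt i hi hc⟩⟩⟩
      refine ⟨e + 1, mem_frontier_succ.2 ⟨_, hd, mem_expand.2 ⟨e, he, ?_,
        h.adjacent j (by omega), rfl⟩⟩, fun i hi hc => ?_⟩
      · rw [card_of_mem_frontier hd]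
        by_cases hjm : j < m
        · exact Or.inl hjm
        · have h0 := h.first_card
          -- Level `j` lies between the core sizes of `g a` and `g (a + 1)`, at most `k` apart; the
          -- distance from `g a` is thus below `k`.
          obtain ⟨a, han, h1, h2⟩ := exists_crossing (fun a => (g a).core.card)
            (j := j) (i := n) (by omega) (by omega)
          have hk := h.step_card a han
          rcases hed with rfl | ⟨rfl, hne⟩
          · omega
          · have := hne a han.le
            have := hdist a han.le (by omega)
            omega
      · rcases hed with rfl | ⟨rfl, hne⟩
        · omega
        · have := hne i hi
          have := hdist i hi (by omega)
          omega
    · intro i hi hc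
      rcases (Nat.lt_succ_iff.1 hc).eq_or_lt with hc | hc
      · exact mem_optima_succ.2 (Or.inr ⟨_, hd, hopt i hi hc⟩)
      · exact mem_optima_succ.2 (Or.inl (hO i hi hc))

theorem exists_outputs (h : IsSearchPath D m k t n v g) : ∃ O, Outputs D m k t O ∧ g n ∈ O := by
  obtain ⟨O, hO, hsub⟩ := Learner.exists_outputs D m k t
  obtain ⟨⟨d, hd, -⟩, hopt⟩ := h.search le_rfl
  refine ⟨O, hO, hsub _ ⟨_, hd⟩ (mem_optima_succ.2 (Or.inr ⟨_, hd, ?_⟩))⟩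
  rw [h.core_eq n le_rfl]
  exact h.mem_optimaAt le_rfl hopt

end IsSearchPath

open Classical in
/-- Vertices named by `f` along an enumeration of core rules. -/
theorem image_take_succ_mem_adjacents {V : Type} {l : List (CoreRule V)} (hl : l.Nodup)
    {f : V → ℕ} (hf : Set.InjOn (CoreRule.map f) {r | r ∈ l})
    (hlt : ∀ j, ∀ r ∈ l.take j, ∀ X ∈ r.symbols, f X < 3 * j) {j : ℕ} (hj : j < l.length) :
    ((l.take (j + 1)).toFinset.image (CoreRule.map f)) ∈
      adjacents ((l.take j).toFinset.image (CoreRule.map f)) := by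
  -- Injectivity makes the bound in `adjacents` equal to `3 * (j + 1)`, which is the naming bound
  -- for the first `j + 1` rules.
  have hcard : ((l.take j).toFinset.image (CoreRule.map f)).card = j := by
    rw [Finset.card_image_of_injOn, List.toFinset_card_of_nodup (hl.sublist (List.take_sublist _ _)),
      List.length_take, min_eq_left hj.le]
    intro r hr r' hr' h
    exact hf (List.mem_of_mem_take (List.mem_toFinset.1 hr))
      (List.mem_of_mem_take (List.mem_toFinset.1 hr')) h
  have htake : l.take (j + 1) = l.take j ++ [l[j]] := (List.take_append_getElem hj).symm
  refine Finset.mem_image.2 ⟨l[j].map f, Finset.mem_sdiff.2 ⟨mem_rulesBelow ?_, ?_⟩, ?_⟩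
  · intro X hX
    obtain ⟨Y, hY, rfl⟩ := CoreRule.mem_symbols_map.1 hX
    rw [hcard]
    exact hlt (j + 1) _ (htake ▸ List.mem_append_right _ (List.mem_singleton_self _)) Y hY
  · intro hmem
    obtain ⟨r, hr, he⟩ := Finset.mem_image.1 hmem
    have hr := List.mem_toFinset.1 hr
    obtain rfl := hf (List.mem_of_mem_take hr) (List.getElem_mem hj) he
    have hnd : (l.take (j + 1)).Nodup := hl.sublist (List.take_sublist _ _)
    rw [htake, List.nodup_append] at hnd
    exact hnd.2.2 _ hr _ (by simp) rfl
  · rw [htake]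
    ext r
    simp only [List.toFinset_append, Finset.image_union, Finset.mem_insert, Finset.mem_union,
      List.toFinset_cons, List.toFinset_nil, insert_empty_eq, Finset.image_singleton,
      Finset.mem_singleton, or_comm]

end Learner

/-! ### Renaming the given path and running the search along it -/

theorem mainTheorem4 {V : Type} {T : Type*} [Fintype T] (m k : ℕ) (t : ℝ)
    (G : PosGrammar V T) (hG : G ∈ PosGrammar.incrementalClass V T m k)
    (D : Finset (List T)) (hD : ∀ w ∈ D, w ∈ G.language)
    (ht : t ≤ G.fitness D)
    (hpath : ∃ (n : ℕ) (s : Fin (n + 1) → PosGrammar V T),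
      PosGrammar.IsIncrementalSeq m k s G ∧ PosGrammar.IsNonincreasingPath D s) :
    ∃ O : Finset (PosGrammar ℕ T), Learner.Outputs D m k t O ∧
      ∃ h ∈ O, h.language = G.language ∧ h.core.card ≤ G.core.card ∧ h.size ≤ G.size := by
  classical
  obtain ⟨n, s, hs, hp⟩ := hpath
  -- Left inverses of renamings need a default nonterminal; the root of a parse tree provides one.
  have hV : Nonempty V := by
    obtain ⟨w, -, hw⟩ := hp.first_parses
    obtain ⟨τ, -⟩ := PosGrammar.mem_language_iff.1 hw
    exact ⟨τ.root⟩
  -- The path is extended to all of `ℕ` by the constant value `G`, so that the cores form a monotone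
  -- sequence.
  obtain ⟨p, hp0, hpn, hpl, hpr⟩ : ∃ p : ℕ → PosGrammar V T, p 0 = s 0 ∧ p n = G ∧
      (∀ i : Fin n, p i = s i.castSucc ∧ p (i + 1) = s i.succ) ∧
      ∀ i, ∃ j, p i = s j ∧ (n ≤ i → p i = G) := by
    refine ⟨fun i => s ⟨min i n, by omega⟩, ?_, ?_, fun i => ⟨?_, ?_⟩, fun i => ⟨_, rfl, ?_⟩⟩
    · exact congrArg s (Fin.ext (Nat.zero_min n))
    · exact (congrArg s (Fin.ext (min_self n))).trans hs.last
    · exact congrArg s (Fin.ext (min_eq_left i.2.le))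
    · exact congrArg s (Fin.ext (min_eq_left (Nat.succ_le_of_lt i.2)))
    · exact fun hi => (congrArg s (Fin.ext (min_eq_right hi))).trans hs.last
  have hsub : ∀ i, (p i).IsSub (p (i + 1)) := by
    intro i
    by_cases hi : i < n
    · have := hpl ⟨i, hi⟩
      simp only at this
      rw [this.1, this.2]
      exact (hs.sub _).1
    · obtain ⟨-, -, h1⟩ := hpr i
      obtain ⟨-, -, h2⟩ := hpr (i + 1)
      rw [h1 (by omega), h2 (by omega)]
      exact PosGrammar.IsSub.refl _
  have hmono : Monotone fun i => (p i).core := monotone_nat_of_le_succ fun i => (hsub i).1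
  have hsubG : ∀ i ≤ n, (p i).IsSub G := by
    intro i hi
    rw [← hpn]
    exact PosGrammar.isSub_of_le (fun i _ => hsub i) hi
  obtain ⟨l, hnd, hl, htake⟩ := Finset.exists_list_of_chain (fun i => (p i).core) hmono n
  simp only [hpn] at hl
  have hlmem : ∀ r, r ∈ l ↔ r ∈ G.core := fun r => by rw [← hl, List.mem_toFinset]
  obtain ⟨f, hinj, hlt⟩ := CoreRule.exists_naming l
  have hfG : Set.InjOn f G.occurring := by
    intro X hX Y hY h
    obtain ⟨r, hr, hX⟩ := PosGrammar.mem_occurring.1 hX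
    obtain ⟨r', hr', hY⟩ := PosGrammar.mem_occurring.1 hY
    exact hinj r ((hlmem r).2 hr) r' ((hlmem r').2 hr') X hX Y hY h
  have hf : ∀ i ≤ n, Set.InjOn f (p i).occurring := fun i hi =>
    hfG.mono (Finset.coe_subset.2 (hsubG i hi).occurring_subset)
  have hcard : ∀ i ≤ n, ((p i).rename f).core.card = (p i).core.card := fun i hi =>
    Finset.card_image_of_injOn (PosGrammar.injOn_coreRule_map (hf i hi))
  have hmap : Set.InjOn (CoreRule.map f) {r | r ∈ l} := by
    convert PosGrammar.injOn_coreRule_map hfG using 1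
    ext r
    exact hlmem r
  have hsearch : Learner.IsSearchPath D m k t n
      (fun j => (l.take j).toFinset.image (CoreRule.map f)) (fun i => (p i).rename f) := by
    constructor
    · simp
    · intro j hj
      refine Learner.image_take_succ_mem_adjacents hnd hmap hlt ?_
      rwa [hcard n le_rfl, hpn, ← hl, List.toFinset_card_of_nodup hnd] at hj
    · intro i hi
      simp only [hcard i hi, htake i hi]
      rfl
    · exact fun i _ => PosGrammar.pos_rename_subset f _
    · exact fun i _ => (hsub i).rename f
    · intro i hi
      obtain ⟨j, hj, -⟩ := hpr i
      rw [PosGrammar.fitnessDefined_rename (hf i hi), hj]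
      exact hp.defined j
    · intro i hi
      rw [PosGrammar.fitness_rename (hf i hi.le), PosGrammar.fitness_rename (hf (i + 1) hi),
        (hpl ⟨i, hi⟩).1, (hpl ⟨i, hi⟩).2]
      exact hp.nonincreasing _
    · rwa [PosGrammar.fitness_rename (hf n le_rfl), hpn]
    · rw [PosGrammar.language_rename (hf 0 n.zero_le), hp0]
      exact hp.first_parses
    · intro i hi
      rw [PosGrammar.language_rename (hf i hi.le), PosGrammar.language_rename (hf (i + 1) hi),
        (hpl ⟨i, hi⟩).1, (hpl ⟨i, hi⟩).2]
      exact hp.parses_more _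
    · rw [hcard 0 n.zero_le, hp0]
      exact hs.first_card
    · intro i hi
      rw [hcard i hi.le, hcard (i + 1) hi, (hpl ⟨i, hi⟩).1, (hpl ⟨i, hi⟩).2]
      exact hs.step_card _
  obtain ⟨O, hO, hmem⟩ := hsearch.exists_outputs
  simp only [hpn] at hmem
  exact ⟨O, hO, _, hmem, PosGrammar.language_rename hfG, PosGrammar.card_core_rename_le f G,
    PosGrammar.size_rename_le f G⟩
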